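/- Let $\mathbb{F}_q$ be a finite field with $q$ elements, $\bar{\mathbb{F}}_q$ an algebraic closure of it, $G=SL_n(\bar{\mathbb{F}}_q)$, and let $k$ be a field of positive characteristic. For $a\ge 1$ regard $SL_n(\mathbb{F}_{q^a})$ as a subgroup of $G$. Let $B$ be the subgroup of upper triangular matrices in $G$, $U$ the subgroup of upper triangular matrices with all diagonal entries $1$, $W=S_n$ the Weyl group with length function $\ell$, and $M(\mathrm{tr})=kG\otimes_{kB}k$ the $kG$-module induced from the trivial module of $B$, with generator $1_{\mathrm{tr}}=1\otimes 1$. Put $$\eta=\sum_{w\in W}(-1)^{\ell(w)}\,n_w 1_{\mathrm{tr}}\in M(\mathrm{tr}),$$ where $n_w\in G$ is a monomial matrix representing $w$. The Steinberg module of $kG$ is the $kG$-submodule $\mathrm{St}=kU\eta$ of $M(\mathrm{tr})$. A quasi-finite sequence of $G$ is a sequence $G_1,G_2,\dots$ of finite subgroups with union $G$ such that for all $i,j$ there is an $r$ with $G_i,G_j\subseteq G_r$. A $kG$-module $M$ is quasi-finite with respect to such a sequence if there are subspaces $M_1,M_2,\dots$ of $M$ such that each $M_i$ is an irreducible $kG_i$-submodule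 of $M$, $M_i\subseteq M_j$ whenever $G_i\subseteq G_j$, and $M=\bigcup_i M_i$. Assume that $\operatorname{char}k$ divides $\prod_{m=2}^{n}\bigl(1+q^a+q^{2a}+\cdots+q^{(m-1)a}\bigr)$ for every integer $a\ge 1$. Then $\mathrm{St}$ is not quasi-finite with respect to any quasi-finite sequence of $G$ that is a subsequence of $SL_n(\mathbb{F}_q),\ SL_n(\mathbb{F}_{q^2}),\ SL_n(\mathbb{F}_{q^3}),\dots$. Moreover, for every $a\ge 1$ the $kSL_n(\mathbb{F}_{q^a})$-module $kSL_n(\mathbb{F}_{q^a})\eta$ is not irreducible. -/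

import Mathlib

open scoped MatrixGroups

namespace InfSteinberg

noncomputable section

/-! ### Groups -/

theorem upper_diag_mul {n : ℕ} {R : Type*} [CommRing R] {A B : Matrix (Fin n) (Fin n) R}
    (hA : A.IsUpperTriangular) (hB : B.IsUpperTriangular) (i : Fin n) :
    (A * B) i i = A i i * B i i := by
  rw [Matrix.mul_apply]
  refine Finset.sum_eq_single i (fun j _ hj => ?_) (by simp)
  rcases lt_or_gt_of_ne hj with h | h
  · rw [hA h, zero_mul]
  · rw [hB h, mul_zero]

/-- The Borel subgroup `B` of `SL_n(K)`: the upper triangular matrices of determinant one. -/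
def borel (n : ℕ) (K : Type*) [Field K] : Subgroup SL(n, K) where
  carrier := {g | (g : Matrix (Fin n) (Fin n) K).IsUpperTriangular}
  one_mem' := by
    simpa using Matrix.blockTriangular_one
  mul_mem' {a b} ha hb := by
    simpa using Matrix.BlockTriangular.mul ha hb
  inv_mem' {a} ha := by
    have : Invertible (a : Matrix (Fin n) (Fin n) K) :=
      Matrix.invertibleOfIsUnitDet _ (by simp)
    have h := Matrix.blockTriangular_inv_of_blockTriangular ha
    have e : ((a⁻¹ : SL(n, K)) : Matrix (Fin n) (Fin n) K) = (a : Matrix (Fin n) (Fin n) K)⁻¹ := by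
      refine (Matrix.inv_eq_right_inv ?_).symm
      rw [← Matrix.SpecialLinearGroup.coe_mul]
      simp
    simpa [e] using h

/-- The unipotent radical `U` of `B`: the upper triangular matrices with all diagonal entries
equal to one. -/
def unipotent (n : ℕ) (K : Type*) [Field K] : Subgroup SL(n, K) where
  carrier := {g | g ∈ borel n K ∧ ∀ i, g i i = 1}
  one_mem' := ⟨(borel n K).one_mem, by simp⟩
  mul_mem' {a b} ha hb := ⟨(borel n K).mul_mem ha.1 hb.1, fun i => by
    have := upper_diag_mul ha.1 hb.1 i
    simpa [ha.2 i, hb.2 i] using this⟩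
  inv_mem' {a} ha := ⟨(borel n K).inv_mem ha.1, fun i => by
    have := upper_diag_mul ha.1 ((borel n K).inv_mem ha.1) i
    rw [← Matrix.SpecialLinearGroup.coe_mul] at this
    simpa [ha.2 i] using this.symm⟩

/-- The number `ℓ(w)` of inversions of a permutation, that is the length of `w` in the Weyl group
`W = S_n` of `SL_n` with respect to the adjacent transpositions. -/
def weylLength {n : ℕ} (w : Equiv.Perm (Fin n)) : ℕ :=
  (Finset.univ.filter fun x : Fin n × Fin n => x.1 < x.2 ∧ w x.2 < w x.1).card

theorem neg_one_pow_weylLength {n : ℕ} (w : Equiv.Perm (Fin n)) :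
    (-1 : ℤˣ) ^ weylLength w = Equiv.Perm.sign w := by
  rw [Equiv.Perm.sign_eq_prod_prod_Ioi, weylLength, Finset.prod_sigma', Finset.prod_ite]
  simp only [Finset.prod_const_one, one_mul, Finset.prod_const]
  congr 1
  refine Finset.card_bij (fun x _ => ⟨x.1, x.2⟩) ?_ ?_ ?_
  · rintro ⟨a, b⟩ h
    simp only [Finset.mem_filter, Finset.mem_univ, true_and] at h
    simp [h.1, h.2.le]
  · rintro ⟨a, b⟩ _ ⟨c, d⟩ _ h
    simpa using h
  · rintro ⟨a, b⟩ h
    simp only [Finset.mem_filter, Finset.mem_sigma, Finset.mem_univ, Finset.mem_Ioi, true_and,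
      not_lt] at h
    refine ⟨(a, b), ?_, rfl⟩
    simp only [Finset.mem_filter, Finset.mem_univ, true_and]
    refine ⟨h.1, lt_of_le_of_ne h.2 fun e => ?_⟩
    exact h.1.ne' (w.injective e)

/-- The monomial matrix of determinant one with nonzero entries in the places `(w j, j)`: all
these entries are `1`, except that the one in the first column is the sign of `w`. -/
def weylRep {n : ℕ} (K : Type*) [Field K] (w : Equiv.Perm (Fin n)) : SL(n, K) :=
  ⟨Matrix.of fun i j =>
      if i = w j then (if (j : ℕ) = 0 then ((Equiv.Perm.sign w : ℤ) : K) else 1) else 0, by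
    have e : (Matrix.of fun i j =>
        if i = w j then (if (j : ℕ) = 0 then ((Equiv.Perm.sign w : ℤ) : K) else 1) else 0) =
        (Matrix.diagonal fun j : Fin n =>
          if (j : ℕ) = 0 then ((Equiv.Perm.sign w : ℤ) : K) else 1).submatrix (w⁻¹ : Equiv.Perm (Fin n)) id := by
      ext i j
      simp only [Matrix.of_apply, Matrix.submatrix_apply, Matrix.diagonal_apply, id]
      by_cases h : i = w j
      · subst h; simp
      · have : w⁻¹ i ≠ j := fun e => h (by simp [← e])
        rw [if_neg h, if_neg this]
    rw [e, Matrix.det_permute, Matrix.det_diagonal, Equiv.Perm.sign_inv]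
    cases n with
    | zero => simp [Subsingleton.elim w 1]
    | succ n =>
      rw [Fin.prod_univ_succ]
      simp only [Fin.val_zero, if_true, Fin.val_succ, Nat.add_eq_zero_iff, one_ne_zero, and_false,
        if_false, Finset.prod_const_one, mul_one]
      rw [← Int.cast_mul, ← Units.val_mul, Int.units_mul_self]
      simp⟩

/-! ### The induced module and the Steinberg module -/

section Steinberg

variable (n : ℕ) (K k : Type*) [Field K] [Field k]

/-- The underlying space of `M(tr) = kG ⊗_{kB} k_tr` for `G = SL_n(K)`. -/
abbrev PrincipalSpace : Type _ :=
  Representation.IndV (borel n K).subtype (Representation.trivial k (borel n K) k)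

/-- The `kG`-module `M(tr) = kG ⊗_{kB} k_tr`, `G = SL_n(K)`: the module induced from the trivial
one-dimensional module of `B`. -/
def principal : Representation k SL(n, K) (PrincipalSpace n K k) :=
  Representation.ind (borel n K).subtype (Representation.trivial k (borel n K) k)

/-- The generator `1_tr = 1 ⊗ 1` of `M(tr)`. -/
def oneTr : PrincipalSpace n K k :=
  Representation.IndV.mk (borel n K).subtype (Representation.trivial k (borel n K) k) 1 1

/-- `w 1_tr = n_w 1_tr` for `w` in the Weyl group `W = S_n`. It does not depend on the choice of
the representative `n_w` of `w`, see `principal_weylVec`. -/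
def weylVec (w : Equiv.Perm (Fin n)) : PrincipalSpace n K k :=
  principal n K k (weylRep K w) (oneTr n K k)

/-- `η = ∑_{w ∈ W} (-1)^{ℓ(w)} w 1_tr`. -/
def eta : PrincipalSpace n K k :=
  ∑ w : Equiv.Perm (Fin n), (-1 : k) ^ weylLength w • weylVec n K k w

variable {n K}

theorem principal_oneTr {b : SL(n, K)} (hb : b ∈ borel n K) :
    principal n K k b (oneTr n K k) = oneTr n K k := by
  have h := Representation.Coinvariants.mk_self_apply
    (V := TensorProduct k (MonoidAlgebra k SL(n, K)) k)
    (Representation.tprod ((Representation.leftRegular k SL(n, K)).comp (borel n K).subtype)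
      (Representation.trivial k (borel n K) k)) ⟨b⁻¹, (borel n K).inv_mem hb⟩
      (TensorProduct.tmul k (MonoidAlgebra.single 1 1) 1)
  simp only [principal, oneTr, Representation.ind_mk]
  simpa using h

theorem principal_mul_apply (g h : SL(n, K)) (v : PrincipalSpace n K k) :
    principal n K k (g * h) v = principal n K k g (principal n K k h v) := by
  rw [map_mul]; rfl

theorem principal_one_apply (v : PrincipalSpace n K k) : principal n K k 1 v = v := by
  rw [map_one]; rfl

/-- If `w'⁻¹ g w` lies in `B` then `g (w 1_tr) = w' 1_tr`. -/
theorem principal_weylVec {g : SL(n, K)} {w w' : Equiv.Perm (Fin n)}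
    (h : ∀ i j, j < i → g (w' i) (w j) = 0) :
    principal n K k g (weylVec n K k w) = weylVec n K k w' := by
  obtain ⟨c, e⟩ : ∃ c, g * weylRep K w = weylRep K w' * c := ⟨(weylRep K w')⁻¹ * (g * weylRep K w), by group⟩
  suffices hc : c ∈ borel n K by
    rw [weylVec, ← principal_mul_apply, e, principal_mul_apply, principal_oneTr k hc, weylVec]
  intro i j hij
  have e2 : (weylRep K w' * c) (w' i) j = (g * weylRep K w) (w' i) j := by rw [e]
  rw [Matrix.SpecialLinearGroup.coe_mul, Matrix.SpecialLinearGroup.coe_mul, Matrix.mul_apply,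
    Matrix.mul_apply, Finset.sum_eq_single i, Finset.sum_eq_single (w j), h i j hij, zero_mul] at e2
  · refine (mul_eq_zero.mp e2).resolve_left ?_
    simp only [weylRep, Matrix.of_apply, if_true]
    split_ifs
    · rcases Int.units_eq_one_or (Equiv.Perm.sign w') with h | h <;> simp [h]
    · exact one_ne_zero
  · intro l _ hl
    simp [weylRep, hl]
  · simp
  · intro l _ hl
    have : w' i ≠ w' l := fun e => hl (w'.injective e).symm
    simp [weylRep, hl.symm]
  · simp

/-- Grouping the terms of `η` into pairs `w`, `s w`, with `s` the transposition of `i < j`. -/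
theorem sum_pair {V : Type*} [AddCommGroup V] [Module k V] {i j : Fin n} (hij : i < j)
    (f : Equiv.Perm (Fin n) → V) :
    ∑ w, (-1 : k) ^ weylLength w • f w =
      ∑ w with w⁻¹ i < w⁻¹ j, (-1 : k) ^ weylLength w • (f w - f (Equiv.swap i j * w)) := by
  have hs (w : Equiv.Perm (Fin n)) : (-1 : k) ^ weylLength w = ((Equiv.Perm.sign w : ℤ) : k) := by
    rw [← neg_one_pow_weylLength]; simp
  simp only [hs]
  rw [← Finset.sum_filter_add_sum_filter_not _ (fun w : Equiv.Perm (Fin n) => w⁻¹ i < w⁻¹ j)]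
  simp only [smul_sub, Finset.sum_sub_distrib]
  rw [sub_eq_add_neg, ← Finset.sum_neg_distrib]
  congr 1
  refine (Finset.sum_bij (fun w _ => Equiv.swap i j * w) ?_ ?_ ?_ ?_).symm
  · intro w hw
    simp only [Finset.mem_filter, Finset.mem_univ, true_and] at hw
    have h1 : (Equiv.swap i j * w)⁻¹ i = w⁻¹ j := by simp [mul_inv_rev, -Equiv.Perm.coe_inv]
    have h2 : (Equiv.swap i j * w)⁻¹ j = w⁻¹ i := by simp [mul_inv_rev, -Equiv.Perm.coe_inv]
    simp only [Finset.mem_filter, Finset.mem_univ, true_and, h1, h2]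
    exact hw.not_gt
  · intro a _ b _ h
    exact mul_left_cancel h
  · intro w hw
    simp only [Finset.mem_filter, Finset.mem_univ, true_and, not_lt] at hw
    refine ⟨Equiv.swap i j * w, ?_, by simp⟩
    simp only [Finset.mem_filter, Finset.mem_univ, true_and]
    have h1 : (Equiv.swap i j * w)⁻¹ i = w⁻¹ j := by simp [mul_inv_rev, -Equiv.Perm.coe_inv]
    have h2 : (Equiv.swap i j * w)⁻¹ j = w⁻¹ i := by simp [mul_inv_rev, -Equiv.Perm.coe_inv]
    rw [h1, h2]
    exact lt_of_le_of_ne hw fun e => hij.ne' (w⁻¹.injective e)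
  · intro w _
    rw [Equiv.Perm.sign_mul, Equiv.Perm.sign_swap hij.ne]
    simp

theorem eta_eq_sum_pair {i j : Fin n} (hij : i < j) :
    eta n K k = ∑ w with w⁻¹ i < w⁻¹ j, (-1 : k) ^ weylLength w •
      (weylVec n K k w - weylVec n K k (Equiv.swap i j * w)) :=
  sum_pair k hij _

/-- Diagonal matrices fix `η`. -/
theorem principal_diagonal_eta {t : SL(n, K)} (ht : ∀ i j, i ≠ j → t i j = 0) :
    principal n K k t (eta n K k) = eta n K k := by
  simp only [eta, map_sum, map_smul]
  refine Finset.sum_congr rfl fun w _ => ?_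
  rw [principal_weylVec]
  intro i j hij
  exact ht _ _ fun e => hij.ne' (w.injective e)

open Matrix.SpecialLinearGroup in
theorem transvection_mul_entry {i j : Fin n} (h : i ≠ j) (c : K) (g : SL(n, K)) (a b : Fin n) :
    (transvection h c * g) a b = g a b + if a = i then c * g j b else 0 := by
  rw [Matrix.SpecialLinearGroup.coe_mul]
  change (Matrix.transvection i j c * (g : Matrix (Fin n) (Fin n) K)) a b = _
  split_ifs with e
  · subst e; rw [Matrix.transvection_mul_apply_same]
  · rw [Matrix.transvection_mul_apply_of_ne _ _ _ _ e, add_zero]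

open Matrix.SpecialLinearGroup in
theorem mul_transvection_entry {i j : Fin n} (h : i ≠ j) (c : K) (g : SL(n, K)) (a b : Fin n) :
    (g * transvection h c) a b = g a b + if b = j then c * g a i else 0 := by
  rw [Matrix.SpecialLinearGroup.coe_mul]
  change ((g : Matrix (Fin n) (Fin n) K) * Matrix.transvection i j c) a b = _
  split_ifs with e
  · subst e; rw [Matrix.mul_transvection_apply_same]
  · rw [Matrix.mul_transvection_apply_of_ne _ _ _ _ e, add_zero]

open Matrix.SpecialLinearGroup in
theorem transvection_entry {i j : Fin n} (h : i ≠ j) (c : K) (a b : Fin n) :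
    (transvection h c) a b = (if a = b then 1 else 0) + if a = i ∧ b = j then c else 0 := by
  have := transvection_mul_entry h c 1 a b
  rw [mul_one] at this
  rw [this]
  simp only [Matrix.SpecialLinearGroup.coe_one, Matrix.one_apply]
  grind

/-- Variant of `principal_weylVec` in terms of the matrix entries. -/
theorem principal_weylVec_pair {g : SL(n, K)} {i j : Fin n} {w w' : Equiv.Perm (Fin n)}
    (s : Fin n → Fin n) (hw : w⁻¹ i < w⁻¹ j) {v : Equiv.Perm (Fin n)} (s' : Fin n → Fin n)
    (h1 : ∀ a, w' a = s (w a)) (h2 : ∀ a, v a = s' (w a))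
    (h : ∀ p r, p ≠ r → ¬ (p = i ∧ r = j) → g (s p) (s' r) = 0) :
    principal n K k g (weylVec n K k v) = weylVec n K k w' := by
  refine principal_weylVec k fun a b hab => ?_
  rw [h1, h2]
  refine h _ _ (fun e => hab.ne' (w.injective e)) ?_
  rintro ⟨rfl, rfl⟩
  simp at hw
  exact absurd hw hab.not_gt

open Matrix.SpecialLinearGroup in
/-- The elements of `SL_2` embedded in the rows and columns `i < j`, acting on `η`. -/
theorem lower_upper_eta [DecidableEq K] {i j : Fin n} (hij : i < j) {c : K} (hc : c ≠ 0) (d : K) :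
    principal n K k (transvection hij.ne' c * transvection hij.ne d) (eta n K k) =
      (if 1 + c * d = 0 then 0 else
        principal n K k (transvection hij.ne (d / (1 + c * d))) (eta n K k)) -
      principal n K k (transvection hij.ne c⁻¹) (eta n K k) := by
  have A (w : Equiv.Perm (Fin n)) (hw : w⁻¹ i < w⁻¹ j) (t : K) :
      principal n K k (transvection hij.ne t) (weylVec n K k w) = weylVec n K k w := by
    refine principal_weylVec_pair k id hw id (by simp) (by simp) fun p r h1 h2 => ?_
    rw [transvection_entry]; grind
  have B (w : Equiv.Perm (Fin n)) (hw : w⁻¹ i < w⁻¹ j) :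
      principal n K k (transvection hij.ne' c * transvection hij.ne d) (weylVec n K k w) =
        principal n K k (transvection hij.ne c⁻¹) (weylVec n K k (Equiv.swap i j * w)) := by
    rw [principal_mul_apply, A w hw, ← principal_weylVec_pair k (Equiv.swap i j) hw id
      (w' := Equiv.swap i j * w) (v := w)
      (g := transvection hij.ne (-c⁻¹) * transvection hij.ne' c) (by simp) (by simp),
      ← principal_mul_apply, ← mul_assoc, transvection_mul_neg, one_mul]
    intro p r h1 h2
    simp only [transvection_mul_entry, transvection_entry, Equiv.swap_apply_def]
    grind
  have C (w : Equiv.Perm (Fin n)) (hw : w⁻¹ i < w⁻¹ j) :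
      principal n K k (transvection hij.ne' c * transvection hij.ne d)
          (weylVec n K k (Equiv.swap i j * w)) =
        if 1 + c * d = 0 then weylVec n K k w else
        principal n K k (transvection hij.ne (d / (1 + c * d)))
          (weylVec n K k (Equiv.swap i j * w)) := by
    split_ifs with h0
    · refine principal_weylVec_pair k id hw (Equiv.swap i j) (by simp) (by simp) ?_
      intro p r h1 h2
      simp only [transvection_mul_entry, transvection_entry, Equiv.swap_apply_def, id]
      grind
    · conv_rhs => rw [← principal_weylVec_pair k (Equiv.swap i j) hw (Equiv.swap i j)
        (w' := Equiv.swap i j * w) (v := Equiv.swap i j * w)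
        (g := transvection hij.ne (-(d / (1 + c * d))) *
          (transvection hij.ne' c * transvection hij.ne d)) (by simp) (by simp) (by
            intro p r h1 h2
            simp only [transvection_mul_entry, transvection_entry, Equiv.swap_apply_def]
            grind)]
      rw [← principal_mul_apply, ← mul_assoc, transvection_mul_neg, one_mul]
  simp only [eta_eq_sum_pair k hij, map_sum, map_smul, map_sub]
  split_ifs with h0
  · rw [zero_sub, ← Finset.sum_neg_distrib]
    refine Finset.sum_congr rfl fun w hw => ?_
    have hw := (Finset.mem_filter.mp hw).2
    rw [B w hw, C w hw, A w hw, if_pos h0, ← smul_neg, neg_sub]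
  · rw [← Finset.sum_sub_distrib]
    refine Finset.sum_congr rfl fun w hw => ?_
    have hw := (Finset.mem_filter.mp hw).2
    rw [B w hw, C w hw, A w hw, A w hw, if_neg h0, ← smul_sub]
    congr 1
    abel

open Matrix.SpecialLinearGroup in
theorem lower_conj {i j : Fin n} (hij : (i : ℕ) + 1 = j) (hne : i < j) (c : K) {u : SL(n, K)}
    (hu : u ∈ unipotent n K) (h0 : u i j = 0) :
    transvection hne.ne' c * u * transvection hne.ne' (-c) ∈ unipotent n K := by
  have hlow : ∀ a b : Fin n, b < a → u a b = 0 := fun a b h => hu.1 h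
  refine ⟨fun a b hab => ?_, fun a => ?_⟩
  · have hab : b < a := hab
    simp only [mul_transvection_entry, transvection_mul_entry]
    rw [hlow a b hab]
    have h1 : a = j → b ≠ i → u i b = 0 := fun e h =>
      hlow _ _ (by simp only [Fin.lt_def, ne_eq, Fin.ext_iff] at *; omega)
    have h2 : b = i → a ≠ j → u a j = 0 := fun e h =>
      hlow _ _ (by simp only [Fin.lt_def, ne_eq, Fin.ext_iff] at *; omega)
    have h3 := hu.2 i
    have h4 := hu.2 j
    grind
  · simp only [mul_transvection_entry, transvection_mul_entry]
    have h3 := hu.2 a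
    grind

variable (n K) in
/-- The subspace `kUη` of `M(tr)`. -/
def steinbergSpace : Submodule k (PrincipalSpace n K k) :=
  Submodule.span k (Set.range fun u : unipotent n K => principal n K k u (eta n K k))

variable (n K) in
/-- The elements of `G` that leave `kUη` stable. -/
def stab : Submonoid SL(n, K) where
  carrier := {g | ∀ v ∈ steinbergSpace n K k, principal n K k g v ∈ steinbergSpace n K k}
  one_mem' v hv := by rwa [principal_one_apply]
  mul_mem' {a b} ha hb v hv := by
    rw [principal_mul_apply]
    exact ha _ (hb _ hv)

theorem mem_stab {g : SL(n, K)} (h : ∀ u ∈ unipotent n K,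
    principal n K k (g * u) (eta n K k) ∈ steinbergSpace n K k) : g ∈ stab n K k := by
  intro v hv
  induction hv using Submodule.span_induction with
  | mem x hx =>
    obtain ⟨u, rfl⟩ := hx
    simp only
    rw [← principal_mul_apply]
    exact h _ u.2
  | zero => simp
  | add x y _ _ hx hy => rw [map_add]; exact add_mem hx hy
  | smul a x _ hx => rw [map_smul]; exact Submodule.smul_mem _ _ hx

theorem unipotent_eta_mem {u : SL(n, K)} (hu : u ∈ unipotent n K) :
    principal n K k u (eta n K k) ∈ steinbergSpace n K k :=
  Submodule.subset_span ⟨⟨u, hu⟩, rfl⟩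

theorem unipotent_mem_stab {u : SL(n, K)} (hu : u ∈ unipotent n K) : u ∈ stab n K k :=
  mem_stab k fun _ h => unipotent_eta_mem k (mul_mem hu h)

theorem diagonal_mem_stab {t : SL(n, K)} (ht : ∀ i j, i ≠ j → t i j = 0) : t ∈ stab n K k := by
  have htB : t ∈ borel n K := fun i j h => ht i j (ne_of_gt h)
  have htB' := (borel n K).inv_mem htB
  refine mem_stab k fun u hu => ?_
  have e : t * u = (t * u * t⁻¹) * t := by group
  rw [e, principal_mul_apply, principal_diagonal_eta k ht]
  refine unipotent_eta_mem k ⟨mul_mem (mul_mem htB hu.1) htB', fun i => ?_⟩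
  have h1 := upper_diag_mul (mul_mem htB hu.1) htB' i
  have h2 := upper_diag_mul htB hu.1 i
  have h3 := upper_diag_mul htB htB' i
  rw [← Matrix.SpecialLinearGroup.coe_mul] at h1 h2 h3
  rw [h1, h2, hu.2 i, mul_one, ← h3, mul_inv_cancel]
  simp

open Matrix.SpecialLinearGroup in
theorem upper_mem_unipotent {i j : Fin n} (hij : i < j) (c : K) :
    transvection hij.ne c ∈ unipotent n K := by
  refine ⟨fun a b h => ?_, fun a => ?_⟩
  · have h : b < a := h
    rw [transvection_entry]
    grind
  · rw [transvection_entry]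
    grind

open Matrix.SpecialLinearGroup in
theorem lower_simple_mem_stab {i j : Fin n} (hij : (i : ℕ) + 1 = j) (hne : i < j) (c : K) :
    transvection hne.ne' c ∈ stab n K k := by
  classical
  rcases eq_or_ne c 0 with rfl | hc
  · simp
  refine mem_stab k fun u hu => ?_
  have hd := upper_mem_unipotent hne (u i j)
  have hd' := upper_mem_unipotent hne (-u i j)
  have h1 := lower_conj hij hne c (mul_mem hu hd') (by
    rw [mul_transvection_entry, if_pos rfl, hu.2 i]; ring)
  have e : transvection hne.ne' c * u =
      (transvection hne.ne' c * (u * transvection hne.ne (-u i j)) * transvection hne.ne' (-c)) *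
        (transvection hne.ne' c * transvection hne.ne (u i j)) := by
    rw [← transvection_inv, ← transvection_inv]; group
  rw [e, principal_mul_apply, lower_upper_eta k hne hc]
  refine unipotent_mem_stab k h1 _ (sub_mem ?_ (unipotent_eta_mem k (upper_mem_unipotent hne _)))
  split_ifs
  · exact zero_mem _
  · exact unipotent_eta_mem k (upper_mem_unipotent hne _)

open Matrix.SpecialLinearGroup in
theorem commutator_transvection {i j l : Fin n} (hij : i ≠ j) (hjl : j ≠ l) (hil : i ≠ l) (c : K) :
    transvection hij c * transvection hjl 1 * transvection hij (-c) * transvection hjl (-1) =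
      transvection hil c := by
  ext a b
  simp only [mul_transvection_entry, transvection_entry]
  grind

open Matrix.SpecialLinearGroup in
theorem lower_mem_stab (m : ℕ) : ∀ {i j : Fin n} (_ : (i : ℕ) + m = j) (hne : i < j) (c : K),
    transvection hne.ne' c ∈ stab n K k := by
  induction m with
  | zero => intro i j h hne; exact absurd h (by have := Fin.lt_def.mp hne; omega)
  | succ m ih =>
    intro i j h hne c
    rcases Nat.eq_zero_or_pos m with rfl | hm
    · exact lower_simple_mem_stab k h hne c
    let l : Fin n := ⟨i + m, by omega⟩
    have h1 : i < l := by simp only [l, Fin.lt_def]; omega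
    have h2 : l < j := by simp only [l, Fin.lt_def]; omega
    have e2 : (l : ℕ) + 1 = j := by simp only [l]; omega
    rw [← commutator_transvection h2.ne' h1.ne' hne.ne' c]
    exact mul_mem (mul_mem (mul_mem (lower_simple_mem_stab k e2 h2 _) (ih rfl h1 _))
      (lower_simple_mem_stab k e2 h2 _)) (ih rfl h1 _)

theorem stab_eq_top (g : SL(n, K)) : g ∈ stab n K k := by
  obtain ⟨L, L', D, hD, rfl⟩ :=
    Matrix.SpecialLinearGroup.exists_list_transvec_mul_diagonal_mul_list_transvec g
  have ht (t : Matrix.TransvectionStruct (Fin n) K) : t.toSpecialLinearGroup ∈ stab n K k := by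
    rcases lt_or_gt_of_ne t.hij with h | h
    · exact unipotent_mem_stab k (upper_mem_unipotent h t.c)
    · exact lower_mem_stab k (t.i - t.j : ℕ) (by have := Fin.lt_def.mp h; omega) h t.c
  refine mul_mem (mul_mem (Submonoid.list_prod_mem _ ?_) (diagonal_mem_stab k ?_))
    (Submonoid.list_prod_mem _ ?_)
  rotate_left
  · intro i j hij
    exact Matrix.diagonal_apply_ne _ hij
  all_goals
    intro x hx
    obtain ⟨t, _, rfl⟩ := List.mem_map.mp hx
    exact ht t

variable (n K) in
/-- The Steinberg module `St = kUη`, a `kG`-submodule of `M(tr)`, where `G = SL_n(K)`. -/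
def steinberg : Subrepresentation (principal n K k) where
  toSubmodule := Submodule.span k (Set.range fun u : unipotent n K =>
    principal n K k u (eta n K k))
  apply_mem_toSubmodule g _ hv := stab_eq_top k g _ hv

/-- `kHη`, the `kH`-submodule of `M(tr)` generated by `η`, for a subgroup `H` of `G = SL_n(K)`. -/
def cyclicEta (n : ℕ) (K k : Type*) [Field K] [Field k] (H : Subgroup SL(n, K)) :
    Subrepresentation ((principal n K k).comp H.subtype) where
  toSubmodule := Submodule.span k (Set.range fun h : H => principal n K k h (eta n K k))
  apply_mem_toSubmodule g v hv := by
    induction hv using Submodule.span_induction with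
    | mem x hx =>
      obtain ⟨h, rfl⟩ := hx
      refine Submodule.subset_span ⟨g * h, ?_⟩
      exact principal_mul_apply k (g : SL(n, K)) h _
    | zero => rw [map_zero]; exact zero_mem _
    | add x y _ _ hx hy => rw [map_add]; exact add_mem hx hy
    | smul a x _ hx => rw [map_smul]; exact Submodule.smul_mem _ _ hx

end Steinberg

/-! ### The groups `SL_n(F_{q^a})` -/

section Finite

variable (F K : Type*) [Field F] [Fintype F] [Field K] [Algebra F K]

/-- The subfield `F_{q^a}` of `K`, where `F` is a finite field with `q` elements and `K` is an
algebraic closure of `F`: the fixed field of the `a`-th power of the Frobenius map `x ↦ x ^ q`. -/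
def fixedSubfield (a : ℕ) : Subfield K :=
  ((FiniteField.frobeniusAlgHom F K ^ a : K →ₐ[F] K) : K →+* K).eqLocusField (RingHom.id K)

theorem mem_fixedSubfield {a : ℕ} {x : K} :
    x ∈ fixedSubfield F K a ↔ x ^ Fintype.card F ^ a = x := by
  simp [fixedSubfield, AlgHom.coe_pow, FiniteField.coe_frobeniusAlgHom, pow_iterate]

/-- `SL_n(F_{q^a})` as a subgroup of `SL_n(K)`. -/
def finiteSL (n a : ℕ) : Subgroup SL(n, K) :=
  (Matrix.SpecialLinearGroup.map (n := Fin n) (fixedSubfield F K a).subtype).range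

end Finite

/-! ### Quasi-finite groups and modules -/

section QuasiFinite

variable {G : Type*} [Group G]

/-- A quasi-finite sequence of a group `G`: a sequence of finite subgroups with union `G`, any two
of which are contained in a third one. -/
def IsQuasiFiniteSequence (S : ℕ → Subgroup G) : Prop :=
  (∀ i, Finite (S i)) ∧ (∀ g : G, ∃ i, g ∈ S i) ∧ ∀ i j, ∃ r, S i ≤ S r ∧ S j ≤ S r

/-- A representation `ρ` of `G` on `V` is quasi-finite with respect to the sequence `S` of
subgroups if there are subspaces `M i` of `V` such that each `M i` is an irreducible
`S i`-submodule of `V`, `M i ⊆ M j` whenever `S i ⊆ S j`, and `V` is the union of the `M i`.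
The notion is used for irreducible `ρ`; irreducibility is not made a part of it, so that its
negation does say that no such subspaces exist. -/
def IsQuasiFinite {k V : Type*} [Field k] [AddCommGroup V] [Module k V]
    (ρ : Representation k G V) (S : ℕ → Subgroup G) : Prop :=
  ∃ M : ∀ i, Subrepresentation (ρ.comp (S i).subtype),
    (∀ i, (M i).toRepresentation.IsIrreducible) ∧
    (∀ i j, S i ≤ S j → (M i).toSubmodule ≤ (M j).toSubmodule) ∧
    ∀ v : V, ∃ i, v ∈ (M i).toSubmodule

end QuasiFinite

end

end InfSteinberg

/-! Let `L` be the field with `q^a` elements, and let `U_L` be the unipotent radical over `L`.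
Identify `M(tr)` with the permutation module on the flags `G/B`. Declaring the flags orthonormal
gives a `G`-invariant bilinear form (`flagForm`). In any `SL_n(L)`-module containing `η`, the
vectors orthogonal to all `gη`, `g ∈ SL_n(L)`, form a submodule `N`, and it is enough to show that
`N` is neither zero nor everything.

The witness for `N ≠ 0` is `v = ∑ uη`, summed over `u ∈ U_L`. By disjointness of the cells `UwB`,
its coefficient at the flag of `w` is `±|U_L ∩ wBw⁻¹|`, a power of `q^a`. Hence the pairing of `v`
with `η` is the Poincaré polynomial of `S_n` at `q^a` (`flagForm_sum_eta`), which vanishes in `k` by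
hypothesis. As `v` is fixed by `U_L` and `SL_n(L)η` lies in the span of `U_L η`
(`map_eta_mem_span`), `v` is in `N`. It is nonzero because its coefficient at the longest element is
`±1`. Finally `η ∉ N`: if `u` has ones everywhere above the diagonal, then `uη` pairs with `η` to
`1`.

Quasi-finiteness would put `η` in some irreducible `M_i`, contradicting this. -/

namespace InfSteinberg

noncomputable section

/-! ### The invariant form on `M(tr)` and its values on `uη`. -/

section InducedModule

variable {n : ℕ} {K k : Type*} [Field K] [Field k]

/-- The linear map on `M(tr)` that sends `h⁻¹ 1_tr` to `φ h`, for a function `φ` that is invariant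
under left translation by `B`. -/
def principalLift {V : Type*} [AddCommGroup V] [Module k V] (φ : SL(n, K) → V)
    (hφ : ∀ b ∈ borel n K, ∀ h, φ (b * h) = φ h) : PrincipalSpace n K k →ₗ[k] V :=
  Representation.Coinvariants.lift _
    (Finsupp.linearCombination k φ ∘ₗ (MonoidAlgebra.coeffLinearEquiv k).toLinearMap ∘ₗ
      (TensorProduct.rid k (MonoidAlgebra k SL(n, K))).toLinearMap) fun b => by
    ext h
    simp [hφ _ b.2]

theorem principalLift_mk {V : Type*} [AddCommGroup V] [Module k V] (φ : SL(n, K) → V)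
    (hφ : ∀ b ∈ borel n K, ∀ h, φ (b * h) = φ h) (h : SL(n, K)) :
    principalLift φ hφ (Representation.IndV.mk (borel n K).subtype
      (Representation.trivial k (borel n K) k) h 1) = φ h := by
  simp [principalLift]

theorem principal_mk (g h : SL(n, K)) :
    principal n K k g (Representation.IndV.mk (borel n K).subtype
      (Representation.trivial k (borel n K) k) h 1) =
    Representation.IndV.mk (borel n K).subtype
      (Representation.trivial k (borel n K) k) (h * g⁻¹) 1 :=
  Representation.ind_mk _ _ _ _ _

theorem principalLift_principal_oneTr {V : Type*} [AddCommGroup V] [Module k V]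
    (φ : SL(n, K) → V) (hφ : ∀ b ∈ borel n K, ∀ h, φ (b * h) = φ h) (g : SL(n, K)) :
    principalLift φ hφ (principal n K k g (oneTr n K k)) = φ g⁻¹ := by
  rw [oneTr, principal_mk, principalLift_mk, one_mul]

theorem principalSpace_hom_ext {V : Type*} [AddCommGroup V] [Module k V]
    {f f' : PrincipalSpace n K k →ₗ[k] V}
    (h : ∀ g, f (principal n K k g (oneTr n K k)) = f' (principal n K k g (oneTr n K k))) :
    f = f' := by
  refine Representation.IndV.hom_ext _ _ fun x => LinearMap.ext_ring ?_
  have := h x⁻¹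
  rwa [oneTr, principal_mk, one_mul, inv_inv] at this

theorem mk_eq_of_borel_mul {b : SL(n, K)} (hb : b ∈ borel n K) (h : SL(n, K)) :
    (((b * h)⁻¹ : SL(n, K)) : SL(n, K) ⧸ borel n K) = ((h⁻¹ : SL(n, K)) : SL(n, K) ⧸ borel n K) := by
  rw [mul_inv_rev, QuotientGroup.eq]
  simpa using hb

variable (n K k) in
/-- The map from `M(tr)` to the permutation module on the flag variety `G / B`. -/
def flagMap : PrincipalSpace n K k →ₗ[k] (SL(n, K) ⧸ borel n K →₀ k) :=
  principalLift (fun h => Finsupp.single ((h⁻¹ : SL(n, K)) : SL(n, K) ⧸ borel n K) 1)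
    fun b hb h => by rw [← mk_eq_of_borel_mul hb h]

theorem flagMap_principal_oneTr (g : SL(n, K)) :
    flagMap n K k (principal n K k g (oneTr n K k)) = Finsupp.single ↑g 1 := by
  rw [flagMap, principalLift_principal_oneTr, inv_inv]

variable (n K k) in
/-- The bilinear form on `M(tr)` for which the flags are orthonormal. -/
def flagForm : PrincipalSpace n K k →ₗ[k] PrincipalSpace n K k →ₗ[k] k :=
  (Finsupp.linearCombination k fun x : SL(n, K) ⧸ borel n K =>
    (Finsupp.lapply x : _ →ₗ[k] k)).compl₁₂ (flagMap n K k) (flagMap n K k)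

open Classical in
theorem flagForm_oneTr (g h : SL(n, K)) :
    flagForm n K k (principal n K k g (oneTr n K k)) (principal n K k h (oneTr n K k)) =
      if h⁻¹ * g ∈ borel n K then 1 else 0 := by
  simp [flagForm, flagMap_principal_oneTr, Finsupp.single_apply, QuotientGroup.eq]

/-- Left translation permutes the flags, so it preserves an orthonormal basis of flags; bilinearity
reduces the claim to this case. -/
theorem flagForm_principal (g : SL(n, K)) (x y : PrincipalSpace n K k) :
    flagForm n K k (principal n K k g x) (principal n K k g y) = flagForm n K k x y := by
  classical
  have : (flagForm n K k).compl₁₂ (principal n K k g) (principal n K k g) = flagForm n K k := by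
    refine principalSpace_hom_ext fun a => principalSpace_hom_ext fun b => ?_
    rw [LinearMap.compl₁₂_apply, ← principal_mul_apply, ← principal_mul_apply, flagForm_oneTr,
      flagForm_oneTr]
    have : (g * b)⁻¹ * (g * a) = b⁻¹ * a := by group
    exact if_congr (by rw [this]) rfl rfl
  exact congr($this x y)

/-- Multiplying by monomial matrices only permutes rows and columns and rescales by units, so
vanishing below the diagonal can be read off the entries of `g`. -/
theorem mem_borel_weylRep {g : SL(n, K)} {w w' : Equiv.Perm (Fin n)} :
    (weylRep K w)⁻¹ * (g * weylRep K w') ∈ borel n K ↔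
      ∀ i j, j < i → g (w i) (w' j) = 0 := by
  obtain ⟨c, hc⟩ : ∃ c, c = (weylRep K w)⁻¹ * (g * weylRep K w') := ⟨_, rfl⟩
  have e : g * weylRep K w' = weylRep K w * c := by rw [hc]; group
  rw [← hc]
  have sgn (σ : Equiv.Perm (Fin n)) (j : Fin n) : weylRep K σ (σ j) j ≠ 0 := by
    simp only [weylRep, Matrix.of_apply, if_true]
    split_ifs
    · rcases Int.units_eq_one_or (Equiv.Perm.sign σ) with h | h <;> simp [h]
    · exact one_ne_zero
  have key (i j) : weylRep K w (w i) i * c i j = g (w i) (w' j) * weylRep K w' (w' j) j := by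
    have e2 : (weylRep K w * c) (w i) j = (g * weylRep K w') (w i) j := by rw [e]
    rw [Matrix.SpecialLinearGroup.coe_mul, Matrix.SpecialLinearGroup.coe_mul, Matrix.mul_apply,
      Matrix.mul_apply, Finset.sum_eq_single i, Finset.sum_eq_single (w' j)] at e2
    · exact e2
    · intro l _ hl
      simp [weylRep, hl]
    · simp
    · intro l _ hl
      simp [weylRep, hl.symm]
    · simp
  refine forall_congr' fun i => forall_congr' fun j => imp_congr Iff.rfl ?_
  have := key i j
  constructor
  · intro h
    rw [h, mul_zero] at this
    exact (mul_eq_zero.mp this.symm).resolve_right (sgn _ _)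
  · intro h
    rw [h, zero_mul] at this
    exact (mul_eq_zero.mp this).resolve_left (sgn _ _)

open Classical in
theorem flagForm_weylVec (g : SL(n, K)) (w w' : Equiv.Perm (Fin n)) :
    flagForm n K k (principal n K k g (weylVec n K k w')) (weylVec n K k w) =
      if ∀ i j, j < i → g (w i) (w' j) = 0 then 1 else 0 := by
  rw [weylVec, weylVec, ← principal_mul_apply, flagForm_oneTr]
  simp only [mem_borel_weylRep]

/-- Disjointness of the cells `U w B`. -/
theorem eq_of_unipotent_mem {u : SL(n, K)} (hu : u ∈ unipotent n K) {w w' : Equiv.Perm (Fin n)}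
    (h : ∀ i j, j < i → u (w i) (w' j) = 0) : w = w' := by
  -- Otherwise the hypothesis would kill a diagonal entry of `u`, which is `1`.
  have le (j) : w⁻¹ (w' j) ≤ j := by
    by_contra hj
    have := h _ _ (not_le.mp hj)
    simp [hu.2] at this
  -- A permutation that never increases its argument is the identity: if it sent `j` below `j`, that
  -- smaller value would already be fixed, against injectivity.
  have eq (j) : w⁻¹ (w' j) = j := by
    induction j using WellFoundedLT.induction with
    | ind j ih =>
      by_contra hj
      have := ih _ (lt_of_le_of_ne (le j) hj)
      exact hj (w'.injective (w⁻¹.injective this))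
  ext1 j
  rw [← Equiv.Perm.eq_inv_iff_eq.mp (eq j).symm]

-- Only the term `w' = w` of `η` can meet the flag of `w`, since the cells of distinct permutations
-- are disjoint.
open Classical in
theorem flagForm_unipotent_eta {u : SL(n, K)} (hu : u ∈ unipotent n K)
    (w : Equiv.Perm (Fin n)) :
    flagForm n K k (principal n K k u (eta n K k)) (weylVec n K k w) =
      (-1) ^ weylLength w * if ∀ i j, j < i → u (w i) (w j) = 0 then 1 else 0 := by
  simp only [eta, map_sum, map_smul, LinearMap.sum_apply, LinearMap.smul_apply, flagForm_weylVec,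
    smul_eq_mul]
  refine Finset.sum_eq_single w (fun w' _ hw => ?_) (by simp)
  rw [if_neg fun h => hw (eq_of_unipotent_mem hu h).symm, mul_zero]

end InducedModule

/-! ### Comparing `M(tr)` over a subfield with `M(tr)` over `K`. -/

section BaseChange

variable {n : ℕ} {L K k : Type*} [Field L] [Field K] [Field k] (f : L →+* K)

theorem map_mem_borel {b : SL(n, L)} (hb : b ∈ borel n L) :
    Matrix.SpecialLinearGroup.map f b ∈ borel n K := fun i j h => by
  have : b i j = 0 := hb h
  simp [this]

theorem map_mem_unipotent {u : SL(n, L)} (hu : u ∈ unipotent n L) :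
    Matrix.SpecialLinearGroup.map f u ∈ unipotent n K :=
  ⟨map_mem_borel f hu.1, fun i => by simp [hu.2 i]⟩

/-- The entries are `0` and `±1`, hence defined over every field; this is what makes `η` compatible
with field extensions. -/
theorem map_weylRep (w : Equiv.Perm (Fin n)) :
    Matrix.SpecialLinearGroup.map f (weylRep L w) = weylRep K w := by
  ext i j
  change f (weylRep L w i j) = weylRep K w i j
  simp [weylRep, apply_ite f]

variable (k) in
/-- The map `M(tr) → M(tr)` for the groups `SL_n(L)` and `SL_n(K)` induced by a homomorphism of
fields `L → K`. -/
def principalMap : PrincipalSpace n L k →ₗ[k] PrincipalSpace n K k :=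
  principalLift (fun h => principal n K k (Matrix.SpecialLinearGroup.map f h⁻¹) (oneTr n K k))
    fun b hb h => by
      rw [mul_inv_rev, map_mul, principal_mul_apply,
        principal_oneTr k (map_mem_borel f ((borel n L).inv_mem hb))]

theorem principalMap_oneTr (g : SL(n, L)) :
    principalMap k f (principal n L k g (oneTr n L k)) =
      principal n K k (Matrix.SpecialLinearGroup.map f g) (oneTr n K k) := by
  rw [principalMap, principalLift_principal_oneTr, inv_inv]

theorem principalMap_principal (g : SL(n, L)) (x : PrincipalSpace n L k) :
    principalMap k f (principal n L k g x) =
      principal n K k (Matrix.SpecialLinearGroup.map f g) (principalMap k f x) := by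
  have : principalMap k f ∘ₗ principal n L k g =
      principal n K k (Matrix.SpecialLinearGroup.map f g) ∘ₗ principalMap k f := by
    refine principalSpace_hom_ext fun a => ?_
    simp only [LinearMap.comp_apply]
    rw [← principal_mul_apply, principalMap_oneTr, principalMap_oneTr, map_mul,
      principal_mul_apply]
  exact congr($this x)

theorem principalMap_eta : principalMap k f (eta n L k) = eta n K k := by
  simp only [eta, map_sum, map_smul, weylVec, principalMap_oneTr, map_weylRep]

/-- `SL_n(L) η` is contained in the span of the `u η` with `u` in the unipotent radical of
`SL_n(L)`. -/
theorem map_eta_mem_span (g : SL(n, L)) :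
    principal n K k (Matrix.SpecialLinearGroup.map f g) (eta n K k) ∈
      Submodule.span k (Set.range fun u : unipotent n L =>
        principal n K k (Matrix.SpecialLinearGroup.map f u) (eta n K k)) := by
  -- Stability of `kUη` holds over every field, so it is applied over `L` and pushed forward to `K`.
  have h := stab_eq_top k g (eta n L k)
    (by simpa [principal_one_apply] using unipotent_eta_mem k (unipotent n L).one_mem)
  have := Submodule.mem_map_of_mem (f := principalMap k f) h
  rw [principalMap_principal, principalMap_eta, steinbergSpace, Submodule.map_span,
    ← Set.range_comp] at this
  simpa only [Function.comp_def, principalMap_principal, principalMap_eta] using this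

end BaseChange

/-! ### The generating function of the length -/

/-- The number of pairs `i < j` with `w i < w j`. -/
def noninversions {n : ℕ} (w : Equiv.Perm (Fin n)) : ℕ :=
  ∑ i, ∑ j, if i < j ∧ w i < w j then 1 else 0

/-- The permutation that maps `0` to `p` and is order isomorphic to `w` on the remaining
places. -/
def consPerm {n : ℕ} (p : Fin (n + 1)) (w : Equiv.Perm (Fin n)) : Equiv.Perm (Fin (n + 1)) :=
  (finSuccEquiv n).trans ((Equiv.optionCongr w).trans (finSuccEquiv' p).symm)

theorem consPerm_zero {n : ℕ} (p : Fin (n + 1)) (w : Equiv.Perm (Fin n)) :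
    consPerm p w 0 = p := by
  simp [consPerm]

theorem consPerm_succ {n : ℕ} (p : Fin (n + 1)) (w : Equiv.Perm (Fin n)) (i : Fin n) :
    consPerm p w i.succ = p.succAbove (w i) := by
  simp [consPerm]

theorem consPerm_bijective (n : ℕ) : Function.Bijective
    fun x : Fin (n + 1) × Equiv.Perm (Fin n) => consPerm x.1 x.2 := by
  rw [Fintype.bijective_iff_injective_and_card]
  refine ⟨?_, by simp [Fintype.card_perm, Nat.factorial_succ]⟩
  rintro ⟨p, w⟩ ⟨p', w'⟩ h
  have hp : p = p' := by
    rw [← consPerm_zero p w, ← consPerm_zero p' w']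
    exact congr($h 0)
  subst hp
  refine Prod.ext rfl (Equiv.ext fun i => Fin.succAbove_right_injective (p := p) ?_)
  rw [← consPerm_succ, ← consPerm_succ]
  exact congr($h i.succ)

/-- Place `0` forms a noninversion with each of the `n - p` places whose value exceeds `p`; the
other places keep the relative order given by `w`. -/
theorem noninversions_consPerm {n : ℕ} (p : Fin (n + 1)) (w : Equiv.Perm (Fin n)) :
    noninversions (consPerm p w) = (n - p) + noninversions w := by
  have h1 : ∑ j, (if p < p.succAbove (w j) then 1 else 0) = n - (p : ℕ) := by
    rw [Equiv.sum_comp w fun l => if p < p.succAbove l then 1 else 0]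
    have := Fin.sum_univ_succAbove (fun l => if p < l then 1 else 0) p
    rw [if_neg (lt_irrefl p), zero_add] at this
    rw [← this, ← Finset.card_filter, Finset.filter_lt_eq_Ioi, Fin.card_Ioi]
    omega
  simp only [noninversions, Fin.sum_univ_succ, consPerm_zero, consPerm_succ, Fin.succ_pos,
    Fin.not_lt_zero, Fin.succ_lt_succ_iff, Fin.succAbove_lt_succAbove_iff, true_and,
    false_and, if_false, zero_add, h1]

theorem sum_pow_noninversions (n x : ℕ) :
    ∑ w : Equiv.Perm (Fin n), x ^ noninversions w =
      ∏ m ∈ Finset.Icc 2 n, ∑ i ∈ Finset.range m, x ^ i := by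
  induction n with
  | zero => simp [noninversions]
  | succ n ih =>
    have hs : ∑ p : Fin (n + 1), x ^ (n - (p : ℕ)) = ∑ i ∈ Finset.range (n + 1), x ^ i := by
      rw [Fin.sum_univ_eq_sum_range fun p => x ^ (n - p)]
      exact Finset.sum_range_reflect (fun i => x ^ i) (n + 1)
    rw [← (consPerm_bijective n).sum_comp, Fintype.sum_prod_type]
    simp only [noninversions_consPerm, pow_add, ← Finset.mul_sum, ← Finset.sum_mul]
    rw [hs, ih]
    -- The new factor has `m = n + 1`. For `n = 0` it equals `1` and lies outside the range of the
    -- product.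
    rcases Nat.eq_zero_or_pos n with rfl | hn
    · simp
    · rw [Finset.prod_Icc_succ_top (by omega), mul_comm]

/-! ### Counting points of the unipotent radical -/

section Count

variable {n : ℕ} {L : Type*} [Field L]

/-- The unitriangular matrix with given entries above the diagonal. -/
def unitriangular (c : Fin n → Fin n → L) : unipotent n L :=
  ⟨⟨Matrix.of fun i j => if i = j then 1 else if i < j then c i j else 0, by
    rw [Matrix.det_of_isUpperTriangular]
    · simp
    · intro i j (h : j < i)
      simp [h.ne', h.not_gt]⟩,
   fun i j (h : j < i) => by simp [h.ne', h.not_gt], fun i => by simp⟩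

theorem unitriangular_apply (c : Fin n → Fin n → L) (i j : Fin n) :
    (unitriangular c : SL(n, L)) i j = if i = j then 1 else if i < j then c i j else 0 := rfl

variable (n L) in
/-- The unipotent radical is parametrized by the entries above the diagonal. -/
def unipotentEquiv : unipotent n L ≃ ({p : Fin n × Fin n // p.1 < p.2} → L) where
  toFun u p := (u : SL(n, L)) p.1.1 p.1.2
  invFun c := unitriangular fun i j => if h : i < j then c ⟨(i, j), h⟩ else 0
  left_inv u := by
    ext i j
    rw [unitriangular_apply]
    rcases lt_trichotomy i j with h | rfl | h
    · simp [h, h.ne]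
    · simp [u.2.2]
    · simp only [h.ne', h.not_gt, if_false]
      exact (u.2.1 h).symm
  right_inv c := by
    ext ⟨⟨i, j⟩, h⟩
    simp only at h
    simp [unitriangular_apply, h, h.ne]

open Classical in
/-- The number of elements of `U ∩ w B w⁻¹`. -/
theorem card_unipotent_filter [Fintype L] [Fintype (unipotent n L)] (w : Equiv.Perm (Fin n)) :
    (Finset.univ.filter fun u : unipotent n L =>
      ∀ i j, j < i → (u : SL(n, L)) (w i) (w j) = 0).card =
      Fintype.card L ^ noninversions w⁻¹ := by
  -- The condition decouples over the coordinates: the entry at `a < b` is free if `w⁻¹ a < w⁻¹ b`,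
  -- and zero otherwise.
  have e : (Finset.univ.filter fun u : unipotent n L =>
      ∀ i j, j < i → (u : SL(n, L)) (w i) (w j) = 0).card =
      (Fintype.piFinset fun p : {p : Fin n × Fin n // p.1 < p.2} =>
        if w⁻¹ p.1.1 < w⁻¹ p.1.2 then (Finset.univ : Finset L) else {0}).card := by
    refine Finset.card_equiv (unipotentEquiv n L) fun u => ?_
    simp only [Finset.mem_filter, Finset.mem_univ, true_and, Fintype.mem_piFinset, unipotentEquiv,
      Equiv.coe_fn_mk]
    constructor
    · rintro h ⟨⟨a, b⟩, hab⟩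
      split_ifs with hw
      · simp
      · have := h (w⁻¹ a) (w⁻¹ b) (lt_of_le_of_ne (not_lt.mp hw)
          fun e => hab.ne' (w⁻¹.injective e))
        simpa using this
    · intro h i j hij
      rcases lt_trichotomy (w i) (w j) with hw | hw | hw
      · have := h ⟨(w i, w j), hw⟩
        simpa [hij.not_gt] using this
      · exact absurd (w.injective hw) hij.ne'
      · exact u.2.1 hw
  rw [e, Fintype.card_piFinset]
  simp only [apply_ite Finset.card, Finset.card_univ, Finset.card_singleton]
  rw [Finset.prod_ite, Finset.prod_const_one, mul_one, Finset.prod_const]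
  congr 1
  rw [noninversions, ← Fintype.sum_prod_type'
    (f := fun i j => if i < j ∧ w⁻¹ i < w⁻¹ j then 1 else 0), ← Finset.card_filter]
  refine Finset.card_bij (fun p _ => p.1) ?_ ?_ ?_
  · rintro ⟨p, hp⟩ h
    simpa [hp] using h
  · rintro p _ p' _ h
    exact Subtype.ext h
  · rintro p h
    simp only [Finset.mem_filter, Finset.mem_univ, true_and] at h
    exact ⟨⟨p, h.1⟩, by simpa using h.2, rfl⟩

end Count

/-- For the longest element `w₀` this makes `U ∩ w₀Bw₀⁻¹` trivial, so the coefficient of `∑ uη`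
there is a sign and survives in every characteristic. -/
theorem noninversions_revPerm_inv (n : ℕ) :
    noninversions (Fin.revPerm : Equiv.Perm (Fin n))⁻¹ = 0 := by
  refine Finset.sum_eq_zero fun i _ => Finset.sum_eq_zero fun j _ => if_neg ?_
  rintro ⟨h1, h2⟩
  exact h1.not_gt (by simpa using h2)

/-- The matrix with all entries above the diagonal equal to one lies in no `w B w⁻¹` except
`B`. -/
theorem eq_one_of_unitriangular_one {n : ℕ} {L : Type*} [Field L] {w : Equiv.Perm (Fin n)}
    (h : ∀ i j, j < i →
      (unitriangular fun _ _ : Fin n => (1 : L) : SL(n, L)) (w i) (w j) = 0) :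
    w = 1 := by
  have mono : StrictMono w := fun j i hij => by
    by_contra hw
    have := h i j hij
    rw [unitriangular_apply, if_neg fun e => hij.ne' (w.injective e), if_pos
      (lt_of_le_of_ne (not_lt.mp hw) fun e => hij.ne' (w.injective e))] at this
    exact one_ne_zero this
  -- A finite chain has only one order automorphism.
  have := Subsingleton.elim (mono.orderIsoOfSurjective w w.surjective) (OrderIso.refl _)
  exact Equiv.ext fun i => congr($this i)

/-! ### A proper nonzero submodule built from the form. -/

section Reducible

variable {n : ℕ} {L K k : Type*} [Field L] [Field K] [Field k] (f : L →+* K)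

open Classical in
theorem flagForm_map_unipotent_eta (u : unipotent n L) (w : Equiv.Perm (Fin n)) :
    flagForm n K k (principal n K k (Matrix.SpecialLinearGroup.map f u) (eta n K k))
        (weylVec n K k w) =
      (-1) ^ weylLength w * if ∀ i j, j < i → (u : SL(n, L)) (w i) (w j) = 0 then 1 else 0 := by
  rw [flagForm_unipotent_eta (map_mem_unipotent f u.2)]
  simp

theorem flagForm_sum_weylVec [Fintype L] [Fintype (unipotent n L)] (w : Equiv.Perm (Fin n)) :
    flagForm n K k (∑ u : unipotent n L,
        principal n K k (Matrix.SpecialLinearGroup.map f u) (eta n K k)) (weylVec n K k w) =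
      (-1) ^ weylLength w * (Fintype.card L : k) ^ noninversions w⁻¹ := by
  classical
  simp only [map_sum, LinearMap.sum_apply, flagForm_map_unipotent_eta, ← Finset.mul_sum,
    Finset.sum_boole, card_unipotent_filter, Nat.cast_pow]

theorem flagForm_eta_right (x : PrincipalSpace n K k) :
    flagForm n K k x (eta n K k) =
      ∑ w : Equiv.Perm (Fin n), (-1) ^ weylLength w * flagForm n K k x (weylVec n K k w) := by
  simp only [eta, map_sum, map_smul, smul_eq_mul]

/-- The norm of `η` over `U` pairs with `η` to the Poincaré polynomial of `W`. -/
theorem flagForm_sum_eta [Fintype L] [Fintype (unipotent n L)] :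
    flagForm n K k (∑ u : unipotent n L,
        principal n K k (Matrix.SpecialLinearGroup.map f u) (eta n K k)) (eta n K k) =
      ((∏ m ∈ Finset.Icc 2 n, ∑ i ∈ Finset.range m, Fintype.card L ^ i : ℕ) : k) := by
  rw [flagForm_eta_right, ← sum_pow_noninversions,
    -- The point count has exponent `noninversions w⁻¹`, hence the reindexing; the two signs of each
    -- term then cancel.
    ← Equiv.sum_comp (Equiv.inv (Equiv.Perm (Fin n)))]
  simp only [flagForm_sum_weylVec, ← mul_assoc, ← mul_pow, Equiv.inv_apply, Nat.cast_sum,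
    Nat.cast_pow]
  simp

/-- A representation of `SL_n(L)`, `L` finite, that contains a copy of `η` is not irreducible if
the characteristic of `k` divides the Poincaré polynomial of `W` at `|L|`. -/
theorem not_isIrreducible_of_map_eq_eta [Fintype L] {ℓ : ℕ} [CharP k ℓ]
    (hℓ : ℓ ∣ ∏ m ∈ Finset.Icc 2 n, ∑ i ∈ Finset.range m, Fintype.card L ^ i)
    {H : Subgroup SL(n, K)} (hH : H = (Matrix.SpecialLinearGroup.map (n := Fin n) f).range)
    {V : Type*} [AddCommGroup V] [Module k V] (ρ : Representation k H V)
    (j : V →ₗ[k] PrincipalSpace n K k) (hj : ∀ h x, j (ρ h x) = principal n K k h (j x))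
    {e : V} (he : j e = eta n K k) : ¬ ρ.IsIrreducible := by
  classical
  intro hirr
  have : Fintype (unipotent n L) := Fintype.ofFinite _
  subst hH
  -- The orthogonal complement of the orbit of `η`, pulled back along `j`. Injectivity of `j` is not
  -- needed, as `v ≠ 0` and `e ∉ N` are both detected after applying `j`.
  let N : Subrepresentation ρ :=
    { toSubmodule := ⨅ g : SL(n, L), LinearMap.ker ((flagForm n K k).flip
        (principal n K k (Matrix.SpecialLinearGroup.map f g) (eta n K k)) ∘ₗ j)
      apply_mem_toSubmodule := by
        rintro ⟨_, h, rfl⟩ x hx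
        simp only [Submodule.mem_iInf, LinearMap.mem_ker, LinearMap.comp_apply,
          LinearMap.flip_apply] at hx ⊢
        intro g
        rw [hj]
        change flagForm n K k (principal n K k (Matrix.SpecialLinearGroup.map f h) (j x)) _ = 0
        rw [← mul_inv_cancel_left h g, map_mul, principal_mul_apply, flagForm_principal]
        exact hx _ }
  have mem_N (x : V) : x ∈ N ↔ ∀ g : SL(n, L), flagForm n K k (j x)
      (principal n K k (Matrix.SpecialLinearGroup.map f g) (eta n K k)) = 0 := by
    change x ∈ N.toSubmodule ↔ _
    simp [N]
  let v : V := ∑ u : unipotent n L, ρ ⟨Matrix.SpecialLinearGroup.map f u, u, rfl⟩ e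
  have hv : j v = ∑ u : unipotent n L,
      principal n K k (Matrix.SpecialLinearGroup.map f u) (eta n K k) := by
    simp only [v, map_sum, hj, he]
  have hvN : v ∈ N := by
    rw [mem_N]
    intro g
    have hle : Submodule.span k (Set.range fun u : unipotent n L =>
        principal n K k (Matrix.SpecialLinearGroup.map f u) (eta n K k)) ≤
        LinearMap.ker (flagForm n K k (j v)) := by
      rw [Submodule.span_le]
      rintro _ ⟨u, rfl⟩
      -- Invariance of `v` under the finite unipotent group moves `u` off `η`, so only the pairing
      -- with `η` itself has to vanish.
      have hu : j v = principal n K k (Matrix.SpecialLinearGroup.map f u) (j v) := by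
        rw [hv, map_sum]
        simp only [← principal_mul_apply, ← map_mul]
        exact (Equiv.sum_comp (Equiv.mulLeft u) fun u' : unipotent n L =>
          principal n K k (Matrix.SpecialLinearGroup.map f u') (eta n K k)).symm
      change flagForm n K k (j v) _ = 0
      rw [hu, flagForm_principal, hv, flagForm_sum_eta, CharP.cast_eq_zero_iff k ℓ]
      exact hℓ
    exact hle (map_eta_mem_span f g)
  have hv0 : v ≠ 0 := by
    intro h0
    have := flagForm_sum_weylVec (k := k) f (Fin.revPerm : Equiv.Perm (Fin n))
    rw [← hv, h0, noninversions_revPerm_inv] at this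
    simp only [map_zero, LinearMap.zero_apply, pow_zero, mul_one] at this
    exact pow_ne_zero _ (neg_ne_zero.mpr one_ne_zero) this.symm
  have heN : e ∉ N := by
    rw [mem_N, he]
    intro h
    -- Pairing `η` with `u⁻¹η` is pairing `uη` with `η`. For this `u` only `w = 1` contributes, with
    -- value `1`.
    have h1 := h (unitriangular fun _ _ => 1 : unipotent n L)⁻¹
    rw [← flagForm_principal (Matrix.SpecialLinearGroup.map f
      (unitriangular fun _ _ => 1 : unipotent n L)), ← principal_mul_apply, ← map_mul,
      mul_inv_cancel, map_one, principal_one_apply, flagForm_eta_right,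
      Finset.sum_eq_single 1] at h1
    · rw [flagForm_map_unipotent_eta, if_pos] at h1
      · simp at h1
      · exact fun i j hij => (unitriangular _).2.1 hij
    · intro w _ hw
      rw [flagForm_map_unipotent_eta, if_neg fun h' => hw (eq_one_of_unitriangular_one h')]
      simp
    · simp
  rcases eq_bot_or_eq_top N with h | h
  · rw [h] at hvN
    exact hv0 hvN
  · rw [h] at heN
    exact heN trivial

end Reducible

/-! ### The order of the fixed field of a Frobenius power. -/

section FixedSubfield

variable (F K : Type*) [Field F] [Fintype F] [Field K] [Algebra F K]

open Polynomial in
theorem natCard_fixedSubfield [IsAlgClosed K] {a : ℕ} (ha : 0 < a) :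
    Nat.card (fixedSubfield F K a) = Fintype.card F ^ a := by
  obtain ⟨p, hp⟩ := CharP.exists F
  have : CharP K p := charP_of_injective_algebraMap (algebraMap F K).injective p
  obtain ⟨m, _, hm⟩ := FiniteField.card F p
  have hdvd : p ∣ Fintype.card F ^ a := by
    rw [hm]
    exact dvd_pow (dvd_pow_self p m.ne_zero) ha.ne'
  have h1 : 1 < Fintype.card F := Fintype.one_lt_card
  have hne : (X ^ Fintype.card F ^ a - X : K[X]) ≠ 0 :=
    FiniteField.X_pow_card_pow_sub_X_ne_zero K ha.ne' h1
  -- The fixed field is the root set of `X^(q^a) - X`. This is separable since `p` divides `q^a`,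
  -- where `a > 0` is needed, and it splits in `K`.
  have key := card_rootSet_eq_natDegree (K := K)
    (galois_poly_separable p _ hdvd : (X ^ Fintype.card F ^ a - X : K[X]).Separable)
    (IsAlgClosed.splits _)
  rw [FiniteField.X_pow_card_pow_sub_X_natDegree_eq K ha.ne' h1] at key
  rw [← key, ← Nat.card_eq_fintype_card]
  refine Nat.card_congr (Equiv.subtypeEquivRight fun x => ?_)
  rw [mem_fixedSubfield, mem_rootSet_of_ne hne]
  simp [sub_eq_zero]

end FixedSubfield

end

end InfSteinberg

theorem proposition3p2 {F K k : Type*} [Field F] [Fintype F] [Field K] [Algebra F K]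
    [IsAlgClosure F K] [Field k] (n ℓ : ℕ) [CharP k ℓ] (hℓ : 0 < ℓ)
    (hdvd : ∀ a : ℕ, 0 < a →
      ℓ ∣ ∏ m ∈ Finset.Icc 2 n, ∑ i ∈ Finset.range m, Fintype.card F ^ (i * a)) :
    (∀ S : ℕ → Subgroup (Matrix.SpecialLinearGroup (Fin n) K),
      InfSteinberg.IsQuasiFiniteSequence S →
      (∃ φ : ℕ → ℕ, StrictMono φ ∧ ∀ i, 0 < φ i ∧ S i = InfSteinberg.finiteSL F K n (φ i)) →
      ¬ InfSteinberg.IsQuasiFinite (InfSteinberg.steinberg n K k).toRepresentation S) ∧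
    ∀ a : ℕ, 0 < a →
      ¬ (InfSteinberg.cyclicEta n K k
        (InfSteinberg.finiteSL F K n a)).toRepresentation.IsIrreducible := by
  have := IsAlgClosure.isAlgClosed F (K := K)
  -- An abstract `V` with an equivariant map to `M(tr)` covers both `kHη` and the `M i`, which are
  -- submodules of `St` rather than of `M(tr)`.
  have main {a : ℕ} (ha : 0 < a) {H : Subgroup (Matrix.SpecialLinearGroup (Fin n) K)}
      (hH : H = InfSteinberg.finiteSL F K n a) {V : Type _} [AddCommGroup V] [Module k V]
      (ρ : Representation k H V) (j : V →ₗ[k] InfSteinberg.PrincipalSpace n K k)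
      (hj : ∀ h x, j (ρ h x) = InfSteinberg.principal n K k h (j x))
      {e : V} (he : j e = InfSteinberg.eta n K k) : ¬ ρ.IsIrreducible := by
    have hc := InfSteinberg.natCard_fixedSubfield F K ha
    have : Finite (InfSteinberg.fixedSubfield F K a) :=
      Nat.finite_of_card_ne_zero (hc ▸ (pow_pos Fintype.card_pos a).ne')
    have := Fintype.ofFinite (InfSteinberg.fixedSubfield F K a)
    rw [Nat.card_eq_fintype_card] at hc
    refine InfSteinberg.not_isIrreducible_of_map_eq_eta (ℓ := ℓ) _ ?_ hH ρ j hj he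
    simpa only [hc, ← pow_mul, mul_comm a] using hdvd a ha
  refine ⟨?_, fun a ha => ?_⟩
  · rintro S - ⟨φ, -, hφ⟩ ⟨M, hirr, -, hM⟩
    have hη : InfSteinberg.eta n K k ∈ (InfSteinberg.steinberg n K k).toSubmodule := by
      change _ ∈ InfSteinberg.steinbergSpace n K k
      simpa [InfSteinberg.principal_one_apply] using
        InfSteinberg.unipotent_eta_mem k (InfSteinberg.unipotent n K).one_mem
    -- The union of the `M i` is `St`, so one of them contains `η`.
    obtain ⟨i, hi⟩ := hM ⟨_, hη⟩
    exact main (hφ i).1 (hφ i).2 _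
      ((InfSteinberg.steinberg n K k).toSubmodule.subtype ∘ₗ (M i).toSubmodule.subtype)
      (fun _ _ => rfl) (e := ⟨_, hi⟩) rfl (hirr i)
  · have hη : InfSteinberg.eta n K k ∈
        (InfSteinberg.cyclicEta n K k (InfSteinberg.finiteSL F K n a)).toSubmodule :=
      Submodule.subset_span ⟨1, InfSteinberg.principal_one_apply k _⟩
    exact main ha rfl _
      (InfSteinberg.cyclicEta n K k (InfSteinberg.finiteSL F K n a)).toSubmodule.subtype
      (fun _ _ => rfl) (e := ⟨_, hη⟩) rfl
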